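/- **Notation.** $\mathbb{R}^n,\mathbb{R}^m$ carry the Euclidean inner product and norm. For $C\subset\mathbb{R}^n$ and $x\in C$, the regular normal cone $\widehat N_C(x)$ is the set of $v$ with $\langle v,x'-x\rangle\le o(\|x'-x\|_2)$ for $x'\in C$, and the normal cone is $N_C(x)=\{v\mid \exists\, v^\nu\to v,\ x^\nu\in C\to x,\ v^\nu\in\widehat N_C(x^\nu)\}$; both are empty if $x\notin C$. For $h:\mathbb{R}^m\to[-\infty,\infty]$, $\operatorname{dom}h=\{z\mid h(z)<\infty\}$, $\operatorname{epi}h=\{(z,\alpha)\in\mathbb{R}^m\times\mathbb{R}\mid h(z)\le\alpha\}$, and $\partial h(z)=\{v\mid (v,-1)\in N_{\operatorname{epi}h}(z,h(z))\}$ if $h(z)\in\mathbb{R}$, $\partial h(z)=\emptyset$ otherwise. $h$ is proper if $\operatorname{epi}h\ne\emptyset$ and $h>-\infty$; it is lsc (convex) if $\operatorname{epi}h$ is closed (convex). Sets $C^\nu$ *set-converge* to $C$ if every limit of points $x^\nu\in C^\nu$ along a subsequence of $\mathbb{N}$ lies in $C$ and every point of $C$ is the limit of a sequence $x^\nu\in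 C^\nu$, $\nu\in\mathbb{N}$; $h^\nu$ *epi-converges* to $h$ if $\operatorname{epi}h^\nu$ set-converges to $\operatorname{epi}h$. $\operatorname{con}$ is the convex hull, sums and multiples of sets are Minkowski sums and multiples, and $\operatorname{dist}(0,C)=\inf_{c\in C}\|c\|_2$, with $\operatorname{dist}(0,\emptyset)=\infty$. "Smooth" means $C^1$. **Theorem.** Let $X,X^\nu\subset\mathbb{R}^n$ ($\nu\in\mathbb{N}$) be nonempty and closed, and suppose that either $X$ and all $X^\nu$ are convex, or $X^\nu=X$ for all $\nu$. Let $h,h^\nu:\mathbb{R}^m\to[-\infty,\infty]$ be proper, lsc and convex, $f_0,f_0^\nu:\mathbb{R}^n\to\mathbb{R}$ smooth, $F=(f_1,\dots,f_m)$ and $F^\nu=(f_1^\nu,\dots,f_m^\nu):\mathbb{R}^n\to\mathbb{R}^m$ locally Lipschitz continuous, and $D_i,D_i^\nu:\mathbb{R}^n\rightrightarrows\mathbb{R}^n$ set-valued mappings, $i=1,\dots,m$. Define $$S(x,y,z)=\{F(x)-z\}\times\big(\partial h(z)-y\big)\times\Big(\nabla f_0(x)+\sum_{i=1}^m y_i\operatorname{con}D_i(x)+N_X(x)\Big),$$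 and $S^\nu$ in the same way from $F^\nu,h^\nu,f_0^\nu,D_i^\nu,X^\nu$. Suppose that (a) $X^\nu$ set-converges to $X$; (b) $h^\nu$ epi-converges to $h$; (c) $f_0^\nu(x^\nu)\to f_0(x)$ and $\nabla f_0^\nu(x^\nu)\to\nabla f_0(x)$ whenever $x^\nu\in X^\nu\to x$; (d) for each $i$, whenever $x^\nu\in X^\nu\to x$ and $v^\nu\in D_i^\nu(x^\nu)$ for all $\nu\in\mathbb{N}$, one has $f_i^\nu(x^\nu)\to f_i(x)$ and $\{v^\nu\}$ is bounded with all its cluster points in $\operatorname{con}D_i(x)$. Then the following hold. (i) Assume $D_i^\nu(x)\neq\emptyset$ for all $\nu$, $i$ and $x\in X^\nu$. Let $\epsilon^\nu\in[0,\infty)$ with $\epsilon^\nu\to0$, let $\operatorname{dist}(0,S^\nu(x^\nu,y^\nu,z^\nu))\le\epsilon^\nu$ for all $\nu$, and let $x^\nu\to\bar x$ along a subsequence of $\mathbb{N}$. If $F(\bar x)\in\operatorname{dom}h$, suppose that $$y\in N_{\operatorname{dom}h}(F(\bar x))\ \text{ and }\ 0\in\sum_{i=1}^m y_i\operatorname{con}D_i(\bar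 x)+N_X(\bar x)\ \Longrightarrow\ y=0;$$ if $F(\bar x)\notin\operatorname{dom}h$, suppose that $$0\in\sum_{i=1}^m y_i\operatorname{con}D_i(\bar x)+N_X(\bar x)\ \Longrightarrow\ y=0.$$ Then there exist $\bar y,\bar z\in\mathbb{R}^m$ with $0\in S(\bar x,\bar y,\bar z)$. (The sequence $\{y^\nu\}$ is not assumed to be bounded.) (ii) Assume $D_i^\nu(x)\neq\emptyset$ for all $\nu$, $i$ and $x\in X^\nu$. If $\operatorname{dist}(0,S^\nu(x^\nu,y^\nu,z^\nu))\le\epsilon^\nu$ for all $\nu$, with $\epsilon^\nu\in[0,\infty)$, $\epsilon^\nu\to0$, and $(\bar x,\bar y,\bar z)$ is a cluster point of $\{(x^\nu,y^\nu,z^\nu)\}$, then $0\in S(\bar x,\bar y,\bar z)$. (iii) If $F$ and all $F^\nu$ are smooth and $D_i(x)=\{\nabla f_i(x)\}$, $D_i^\nu(x)=\{\nabla f_i^\nu(x)\}$ for all $i$, $\nu$ and $x$, then for every $(\bar x,\bar y,\bar z)$ with $0\in S(\bar x,\bar y,\bar z)$ there are $(x^\nu,y^\nu,z^\nu)\to(\bar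 x,\bar y,\bar z)$ and $\epsilon^\nu\in[0,\infty)$, $\epsilon^\nu\to0$, with $\operatorname{dist}(0,S^\nu(x^\nu,y^\nu,z^\nu))\le\epsilon^\nu$ for all $\nu$. (iv) If $X^\nu=X$, $F^\nu=F$ and $D_i^\nu=D_i$ for all $\nu$ and $i$, then the conclusion of (iii) holds. -/

import Mathlib

open Filter Topology
open scoped Pointwise ENNReal Gradient

namespace GlobalApprox

noncomputable section

/-- `ℝⁿ` with the Euclidean norm. -/
abbrev Rn (n : ℕ) : Type := EuclideanSpace ℝ (Fin n)

section SetLimits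

variable {E : Type*} [TopologicalSpace E]

/-- Inner limit: the limits of sequences with `xs ν ∈ C ν` for all `ν`. -/
def limInn (C : ℕ → Set E) : Set E :=
  {x | ∃ xs : ℕ → E, (∀ ν, xs ν ∈ C ν) ∧ Tendsto xs atTop (𝓝 x)}

/-- Outer limit: the limits of sequences selected from the sets along a subsequence `φ`. -/
def limOut (C : ℕ → Set E) : Set E :=
  {x | ∃ φ : ℕ → ℕ, StrictMono φ ∧
    ∃ xs : ℕ → E, (∀ k, xs k ∈ C (φ k)) ∧ Tendsto xs atTop (𝓝 x)}

/-- Set-convergence of `C ν` to `C₀` (Painlevé–Kuratowski). -/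
def SetConverges (C : ℕ → Set E) (C₀ : Set E) : Prop :=
  limOut C ⊆ C₀ ∧ C₀ ⊆ limInn C

end SetLimits

section Normals

variable {E : Type*} [NormedAddCommGroup E] [InnerProductSpace ℝ E]

/-- Regular normal cone: `⟨v, x' - x⟩ ≤ o(‖x' - x‖)` for `x' ∈ C`; empty when `x ∉ C`. -/
def regularNormalCone (C : Set E) (x : E) : Set E :=
  {v | x ∈ C ∧ ∀ ε : ℝ, 0 < ε → ∀ᶠ x' in 𝓝[C] x, inner ℝ v (x' - x) ≤ ε * ‖x' - x‖}

/-- (Limiting) normal cone; empty when `x ∉ C`. -/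
def normalCone (C : Set E) (x : E) : Set E :=
  {v | x ∈ C ∧ ∃ (xs vs : ℕ → E), (∀ ν, xs ν ∈ C) ∧ Tendsto xs atTop (𝓝 x) ∧
    Tendsto vs atTop (𝓝 v) ∧ ∀ ν, vs ν ∈ regularNormalCone C (xs ν)}

end Normals

section ExtendedReal

variable {m : ℕ}

/-- Effective domain. -/
def effDom (h : Rn m → EReal) : Set (Rn m) := {z | h z < ⊤}

/-- Epigraph, as a subset of `ℝᵐ × ℝ` with the Euclidean (ℓ²) structure. -/
def epi (h : Rn m → EReal) : Set (WithLp 2 (Rn m × ℝ)) :=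
  {p | h p.fst ≤ ((p.snd : ℝ) : EReal)}

/-- Proper, lower semicontinuous and convex, all expressed through the epigraph. -/
structure ProperLscConvex (h : Rn m → EReal) : Prop where
  epi_nonempty : (epi h).Nonempty
  ne_bot : ∀ z, h z ≠ ⊥
  epi_closed : IsClosed (epi h)
  epi_convex : Convex ℝ (epi h)

/-- Epi-convergence: set-convergence of the epigraphs. -/
def EpiConverges (hν : ℕ → Rn m → EReal) (h : Rn m → EReal) : Prop :=
  SetConverges (fun ν => epi (hν ν)) (epi h)

/-- Subdifferential: `v` with `(v, -1)` normal to the epigraph at `(z, h z)`;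
empty where `h` is not finite. -/
def subdiff (h : Rn m → EReal) (z : Rn m) : Set (Rn m) :=
  {v | h z ≠ ⊥ ∧ h z ≠ ⊤ ∧
    WithLp.toLp 2 (v, (-1 : ℝ)) ∈ normalCone (epi h) (WithLp.toLp 2 (z, (h z).toReal))}

end ExtendedReal

section Stationarity

variable {n m : ℕ}

/-- `∑ᵢ yᵢ con Dᵢ(x) + N_X(x)` (Minkowski operations). -/
def multiplierSet (X : Set (Rn n)) (D : Fin m → Rn n → Set (Rn n)) (x : Rn n) (y : Rn m) :
    Set (Rn n) :=
  (∑ i, y i • convexHull ℝ (D i x)) + normalCone X x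

/-- The set-valued mapping
`S(x,y,z) = {F(x) - z} × (∂h(z) - y) × (∇f₀(x) + ∑ᵢ yᵢ con Dᵢ(x) + N_X(x))`. -/
def statMap (X : Set (Rn n)) (f₀ : Rn n → ℝ) (h : Rn m → EReal) (F : Rn n → Rn m)
    (D : Fin m → Rn n → Set (Rn n)) (x : Rn n) (y z : Rn m) : Set (Rn m × Rn m × Rn n) :=
  {F x - z} ×ˢ ((subdiff h z - {y}) ×ˢ ({∇ f₀ x} + multiplierSet X D x y))

/-- Euclidean distance from the origin to a subset of `ℝᵐ × ℝᵐ × ℝⁿ`; it is `∞` for the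
empty set. -/
def distZero (C : Set (Rn m × Rn m × Rn n)) : ℝ≥0∞ :=
  ⨅ s ∈ C, ENNReal.ofReal (Real.sqrt (‖s.1‖ ^ 2 + ‖s.2.1‖ ^ 2 + ‖s.2.2‖ ^ 2))

/-- Basic qualification at `x`. -/
def BasicQualification (X : Set (Rn n)) (h : Rn m → EReal) (F : Rn n → Rn m)
    (D : Fin m → Rn n → Set (Rn n)) (x : Rn n) : Prop :=
  ∀ y : Rn m, y ∈ normalCone (effDom h) (F x) → 0 ∈ multiplierSet X D x y → y = 0

/-- The qualification used at points `x` with `F x ∉ dom h`. -/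
def InfeasQualification (X : Set (Rn n)) (D : Fin m → Rn n → Set (Rn n)) (x : Rn n) : Prop :=
  ∀ y : Rn m, 0 ∈ multiplierSet X D x y → y = 0

/-- The points `(x ν, y ν, z ν)` are near-stationary for the mappings `Sν ν` with
tolerances `ε ν ∈ [0, ∞)` that vanish. -/
def NearStationary (Sν : ℕ → Rn n → Rn m → Rn m → Set (Rn m × Rn m × Rn n))
    (ε : ℕ → ℝ) (x : ℕ → Rn n) (y z : ℕ → Rn m) : Prop :=
  (∀ ν, 0 ≤ ε ν) ∧ Tendsto ε atTop (𝓝 0) ∧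
    ∀ ν, distZero (Sν ν (x ν) (y ν) (z ν)) ≤ ENNReal.ofReal (ε ν)

/-- Every zero of `S` is the limit of points that are near-stationary for the `Sν ν`
with vanishing tolerances. -/
def ZerosApproximable (S : Rn n → Rn m → Rn m → Set (Rn m × Rn m × Rn n))
    (Sν : ℕ → Rn n → Rn m → Rn m → Set (Rn m × Rn m × Rn n)) : Prop :=
  ∀ (xb : Rn n) (yb zb : Rn m), 0 ∈ S xb yb zb →
    ∃ (x : ℕ → Rn n) (y z : ℕ → Rn m) (ε : ℕ → ℝ),
      Tendsto (fun ν => (x ν, y ν, z ν)) atTop (𝓝 (xb, yb, zb)) ∧ NearStationary Sν ε x y z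

end Stationarity

end

end GlobalApprox

open GlobalApprox

/-!
Normals to converging convex sets are characterized by a variational inequality, which passes to
limits; conversely, a normal `v` to the limit set at `x` is recovered by projecting `x + v` on the
approximating sets. Applied to epigraphs, this yields both directions for subgradients. Bounded
selections from the convex hulls of the `D i` are controlled by Carathéodory's theorem.

When the multipliers `y ν` have a bounded subsequence, a limit of them is a multiplier for the limit
problem. Otherwise the directions `y ν / ‖y ν‖` cluster at a unit vector which, after dividing all
inclusions by `‖y ν‖`, satisfies the multiplier inclusion without the term `∇ f₀` and is normal to
`dom h` if `F x` belongs to it; the qualifications exclude such a vector.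
-/

namespace GlobalApprox

section SetLimits

variable {E G : Type*} [TopologicalSpace E] {C : ℕ → Set E} {C₀ : Set E} {φ : ℕ → ℕ}

theorem SetConverges.mem_of_tendsto (hC : SetConverges C C₀) {x : E} {xs : ℕ → E}
    (hxs : ∀ ν, xs ν ∈ C ν) (hlim : Tendsto xs atTop (𝓝 x)) : x ∈ C₀ :=
  hC.1 ⟨id, strictMono_id, xs, hxs, hlim⟩

theorem SetConverges.mem_of_mapClusterPt [FirstCountableTopology E] (hC : SetConverges C C₀)
    {x : E} {xs : ℕ → E} (hxs : ∀ ν, xs ν ∈ C ν) (hx : MapClusterPt x atTop xs) : x ∈ C₀ := by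
  obtain ⟨φ, hφ, hlim⟩ := hx.tendsto_subseq
  exact hC.1 ⟨φ, hφ, xs ∘ φ, fun k => hxs (φ k), hlim⟩

theorem SetConverges.comp_strictMono (hC : SetConverges C C₀) (hφ : StrictMono φ) :
    SetConverges (C ∘ φ) C₀ := by
  refine ⟨fun x ⟨ψ, hψ, xs, hxs, hlim⟩ => hC.1 ⟨φ ∘ ψ, hφ.comp hψ, xs, hxs, hlim⟩, fun x hx => ?_⟩
  obtain ⟨xs, hxs, hlim⟩ := hC.2 hx
  exact ⟨xs ∘ φ, fun k => hxs (φ k), hlim.comp hφ.tendsto_atTop⟩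

theorem extend_mem_of_forall_mem {A : ℕ → Set G} {us ws : ℕ → G} (hφ : StrictMono φ)
    (hus : ∀ k, us k ∈ A (φ k)) (hws : ∀ ν, ws ν ∈ A ν) (ν : ℕ) :
    Function.extend φ us ws ν ∈ A ν := by
  by_cases hν : ∃ k, φ k = ν
  · obtain ⟨k, rfl⟩ := hν
    rw [hφ.injective.extend_apply]
    exact hus k
  · rw [Function.extend_apply' _ _ _ hν]
    exact hws ν

theorem tendsto_extend_of_strictMono {us ws : ℕ → E} {x : E} (hφ : StrictMono φ)
    (hus : Tendsto us atTop (𝓝 x)) (hws : Tendsto ws atTop (𝓝 x)) :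
    Tendsto (Function.extend φ us ws) atTop (𝓝 x) := by
  intro U hU
  obtain ⟨K, hK⟩ := eventually_atTop.1 (hus.eventually_mem hU)
  rw [mem_map]
  filter_upwards [hws.eventually_mem hU, eventually_ge_atTop (φ K)] with ν hν hge
  by_cases hr : ∃ k, φ k = ν
  · obtain ⟨k, rfl⟩ := hr
    simpa only [Set.mem_preimage, hφ.injective.extend_apply] using hK k (hφ.le_iff_le.1 hge)
  · simpa only [Set.mem_preimage, Function.extend_apply' _ _ _ hr] using hν

theorem SetConverges.exists_tendsto_extension (hC : SetConverges C C₀) (hφ : StrictMono φ)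
    {us : ℕ → E} {x : E} (hus : ∀ k, us k ∈ C (φ k)) (hlim : Tendsto us atTop (𝓝 x)) :
    ∃ xs : ℕ → E, (∀ ν, xs ν ∈ C ν) ∧ Tendsto xs atTop (𝓝 x) ∧ ∀ k, xs (φ k) = us k := by
  obtain ⟨ws, hws, hwl⟩ := hC.2 (hC.1 ⟨φ, hφ, us, hus, hlim⟩)
  exact ⟨Function.extend φ us ws, extend_mem_of_forall_mem hφ hus hws,
    tendsto_extend_of_strictMono hφ hlim hwl, hφ.injective.extend_apply us ws⟩

/-- Continuous convergence of the mappings `g ν` to `g₀` relative to the sets `C ν`. -/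
def ContinuouslyConverges [TopologicalSpace G] (C : ℕ → Set E) (g : ℕ → E → G) (g₀ : E → G) :
    Prop :=
  ∀ (x : E) (xs : ℕ → E), (∀ ν, xs ν ∈ C ν) → Tendsto xs atTop (𝓝 x) →
    Tendsto (fun ν => g ν (xs ν)) atTop (𝓝 (g₀ x))

theorem ContinuouslyConverges.comp_strictMono [TopologicalSpace G] {g : ℕ → E → G} {g₀ : E → G}
    (hg : ContinuouslyConverges C g g₀) (hC : SetConverges C C₀) (hφ : StrictMono φ) :
    ContinuouslyConverges (C ∘ φ) (g ∘ φ) g₀ := by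
  intro x us hus hlim
  obtain ⟨xs, hxs, hxl, heq⟩ := hC.exists_tendsto_extension hφ hus hlim
  refine ((hg x xs hxs hxl).comp hφ.tendsto_atTop).congr fun k => ?_
  simp only [Function.comp_apply, heq]

/-- Outer convergence of the set-valued mappings `A ν` to `A₀` relative to the sets `C ν`, with
local boundedness: selections of `A ν` along a convergent sequence of points of `C ν` are bounded
and cluster only in the value of `A₀` at the limit. -/
def OuterConvergesBoundedly [PseudoMetricSpace G] (C : ℕ → Set E) (A : ℕ → E → Set G)
    (A₀ : E → Set G) : Prop :=
  ∀ (x : E) (xs : ℕ → E) (vs : ℕ → G), (∀ ν, xs ν ∈ C ν) → Tendsto xs atTop (𝓝 x) →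
    (∀ ν, vs ν ∈ A ν (xs ν)) →
    Bornology.IsBounded (Set.range vs) ∧ ∀ v, MapClusterPt v atTop vs → v ∈ A₀ x

namespace OuterConvergesBoundedly

theorem comp_strictMono [PseudoMetricSpace G] {A : ℕ → E → Set G} {A₀ : E → Set G}
    (hA : OuterConvergesBoundedly C A A₀) (hC : SetConverges C C₀)
    (hne : ∀ ν, ∀ x ∈ C ν, (A ν x).Nonempty) (hφ : StrictMono φ) :
    OuterConvergesBoundedly (C ∘ φ) (A ∘ φ) A₀ := by
  intro x us vs hus hlim hvs
  obtain ⟨xs, hxs, hxl, heq⟩ := hC.exists_tendsto_extension hφ hus hlim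
  choose es hes using fun ν => hne ν (xs ν) (hxs ν)
  have hmem : ∀ ν, Function.extend φ vs es ν ∈ A ν (xs ν) :=
    extend_mem_of_forall_mem hφ (fun k => by rw [heq]; exact hvs k) hes
  obtain ⟨hbdd, hcluster⟩ := hA x xs _ hxs hxl hmem
  have hsub : Function.extend φ vs es ∘ φ = vs := Function.extend_comp hφ.injective vs es
  rw [← hsub]
  exact ⟨hbdd.subset (Set.range_comp_subset_range _ _),
    fun v hv => hcluster v (hv.of_comp hφ.tendsto_atTop)⟩

variable [MetricSpace G] [ProperSpace G]

theorem tendsto_of_subsingleton {A : ℕ → E → Set G} {A₀ : E → Set G}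
    (hA : OuterConvergesBoundedly C A A₀) {x : E} {a : G} (hsub : (A₀ x).Subsingleton)
    (ha : a ∈ A₀ x) {xs : ℕ → E} {vs : ℕ → G} (hxs : ∀ ν, xs ν ∈ C ν)
    (hlim : Tendsto xs atTop (𝓝 x)) (hvs : ∀ ν, vs ν ∈ A ν (xs ν)) : Tendsto vs atTop (𝓝 a) := by
  obtain ⟨hbdd, hcluster⟩ := hA x xs vs hxs hlim hvs
  exact hbdd.isCompact_closure.tendsto_nhds_of_unique_mapClusterPt
    (Eventually.of_forall fun ν => subset_closure ⟨ν, rfl⟩) fun v _ hv => hsub (hcluster v hv) ha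

theorem exists_subseq_tendsto {ι : Type*} [Finite ι] {A : ι → ℕ → E → Set G}
    {A₀ : ι → E → Set G} (hA : ∀ i, OuterConvergesBoundedly C (A i) (A₀ i)) {x : E} {xs : ℕ → E}
    {vs : ℕ → ι → G} (hxs : ∀ ν, xs ν ∈ C ν) (hlim : Tendsto xs atTop (𝓝 x))
    (hvs : ∀ ν i, vs ν i ∈ A i ν (xs ν)) :
    ∃ (ψ : ℕ → ℕ) (v : ι → G), StrictMono ψ ∧ (∀ i, v i ∈ A₀ i x) ∧
      Tendsto (vs ∘ ψ) atTop (𝓝 v) := by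
  cases nonempty_fintype ι
  have hsel := fun i => hA i x xs (fun ν => vs ν i) hxs hlim fun ν => hvs ν i
  have hbdd : Bornology.IsBounded (Set.univ.pi fun i => Set.range fun ν => vs ν i) :=
    Bornology.IsBounded.pi fun i => (hsel i).1
  obtain ⟨v, _, ψ, hψ, hv⟩ := tendsto_subseq_of_bounded hbdd fun ν i _ => ⟨ν, rfl⟩
  exact ⟨ψ, v, hψ, fun i => (hsel i).2 _ (.of_comp hψ.tendsto_atTop (hv.apply_nhds i).mapClusterPt),
    hv⟩

end OuterConvergesBoundedly

end SetLimits

section ConvexHull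

theorem convexHull_range_eq_image_stdSimplex {ι R E : Type*} [Fintype ι] [Field R] [LinearOrder R]
    [IsStrictOrderedRing R] [AddCommGroup E] [Module R E] (p : ι → E) :
    convexHull R (Set.range p) = Fintype.linearCombination R p '' stdSimplex R ι := by
  classical
  rw [← convexHull_rangle_single_eq_stdSimplex, LinearMap.image_convexHull, ← Set.range_comp]
  congr 2
  ext i
  simp [Fintype.linearCombination_apply_single]

theorem exists_range_subset_mem_convexHull_range {R E : Type*} [Field R] [LinearOrder R]
    [IsStrictOrderedRing R] [AddCommGroup E] [Module R E] [FiniteDimensional R E] {s : Set E}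
    {x : E} (hx : x ∈ convexHull R s) :
    ∃ p : Fin (Module.finrank R E + 1) → E, Set.range p ⊆ s ∧ x ∈ convexHull R (Set.range p) := by
  rw [convexHull_eq_union] at hx
  simp only [Set.mem_iUnion, exists_prop] at hx
  obtain ⟨t, hts, hind, hxt⟩ := hx
  have : Nonempty t := (convexHull_nonempty_iff.1 ⟨x, hxt⟩).to_subtype
  have hcard : Fintype.card t ≤ Fintype.card (Fin (Module.finrank R E + 1)) := by
    rw [Fintype.card_fin]
    exact hind.card_le_finrank_succ.trans (by gcongr; exact Submodule.finrank_le _)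
  obtain ⟨e⟩ := Function.Embedding.nonempty_of_card_le hcard
  have hrange : Set.range (Subtype.val ∘ Function.invFun e) = (t : Set E) := by
    rw [(Function.invFun_surjective e.injective).range_comp, Subtype.range_coe]
  exact ⟨_, hrange.trans_subset hts, by rwa [hrange]⟩

theorem exists_tendsto_of_isBounded_range {α G : Type*} [PseudoMetricSpace G] [ProperSpace G]
    {u : α → G} (hu : Bornology.IsBounded (Set.range u)) (U : Ultrafilter α) :
    ∃ a, Tendsto u U (𝓝 a) := by
  obtain ⟨a, _, ha⟩ := hu.isCompact_closure.ultrafilter_le_nhds' (U.map u)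
    (Ultrafilter.mem_map.2 (univ_mem' fun ν => subset_closure ⟨ν, rfl⟩))
  exact ⟨a, ha⟩

theorem OuterConvergesBoundedly.convexHull {E G : Type*} [TopologicalSpace E]
    [NormedAddCommGroup G] [NormedSpace ℝ G] [FiniteDimensional ℝ G] {C : ℕ → Set E}
    {A : ℕ → E → Set G} {A₀ : E → Set G} (hA : OuterConvergesBoundedly C A A₀)
    (hconv : ∀ x, Convex ℝ (A₀ x)) :
    OuterConvergesBoundedly C (fun ν x => convexHull ℝ (A ν x)) A₀ := by
  have := FiniteDimensional.proper ℝ G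
  intro x xs vs hxs hlim hvs
  -- By Carathéodory, `vs ν` is a convex combination of `finrank + 1` points `p ν i`.
  choose p hpA hvp using fun ν => exists_range_subset_mem_convexHull_range (hvs ν)
  have hsel := fun i => hA x xs (fun ν => p ν i) hxs hlim fun ν => hpA ν ⟨i, rfl⟩
  refine ⟨?_, fun v hv => ?_⟩
  · have hbdd : Bornology.IsBounded (⋃ i, Set.range fun ν => p ν i) :=
      Bornology.isBounded_iUnion.2 fun i => (hsel i).1
    refine (isBounded_convexHull.2 hbdd).subset (Set.range_subset_iff.2 fun ν => ?_)
    refine convexHull_mono (Set.range_subset_iff.2 fun i => ?_) (hvp ν)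
    exact Set.mem_iUnion.2 ⟨i, ν, rfl⟩
  · simp only [convexHull_range_eq_image_stdSimplex] at hvp
    choose w hw hwp using hvp
    obtain ⟨U, hU, hvU⟩ := mapClusterPt_iff_ultrafilter.1 hv
    choose q hq using fun i => exists_tendsto_of_isBounded_range (hsel i).1 U
    obtain ⟨w₀, hw₀, hwU⟩ := (isCompact_stdSimplex ℝ _).ultrafilter_le_nhds' (U.map w)
      (Ultrafilter.mem_map.2 (univ_mem' hw))
    have hwU : Tendsto w U (𝓝 w₀) := hwU
    have hsum : Tendsto vs U (𝓝 (∑ i, w₀ i • q i)) := by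
      simp only [← funext hwp, Fintype.linearCombination_apply]
      exact tendsto_finsetSum _ fun i _ => (hwU.apply_nhds i).smul (hq i)
    rw [tendsto_nhds_unique hvU hsum]
    refine (hconv x).sum_mem (fun i _ => hw₀.1 i) hw₀.2 fun i _ => (hsel i).2 _ ?_
    exact mapClusterPt_iff_ultrafilter.2 ⟨U, hU, hq i⟩

end ConvexHull

section NormalCone

variable {E : Type*} [NormedAddCommGroup E] [InnerProductSpace ℝ E] {C : Set E}
  {Cν : ℕ → Set E} {x v : E}

theorem inner_nonpos_of_mem_regularNormalCone (hC : Convex ℝ C) (hv : v ∈ regularNormalCone C x)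
    {x' : E} (hx' : x' ∈ C) : inner ℝ v (x' - x) ≤ 0 := by
  obtain ⟨hx, hv⟩ := hv
  have hsegment : Tendsto (fun t : ℝ => x + t • (x' - x)) (𝓝[>] 0) (𝓝[C] x) := by
    refine tendsto_nhdsWithin_iff.2 ⟨?_, ?_⟩
    · have : Continuous fun t : ℝ => x + t • (x' - x) := by fun_prop
      simpa using (this.tendsto 0).mono_left nhdsWithin_le_nhds
    · filter_upwards [Ioc_mem_nhdsGT (zero_lt_one' ℝ)] with t ht
      exact hC.add_smul_sub_mem hx hx' ⟨ht.1.le, ht.2⟩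
  have hbound : ∀ ε : ℝ, 0 < ε → inner ℝ v (x' - x) ≤ ε * ‖x' - x‖ := by
    intro ε hε
    obtain ⟨t, ht, ht0 : 0 < t⟩ :=
      ((hsegment.eventually (hv ε hε)).and self_mem_nhdsWithin).exists
    rw [add_sub_cancel_left, inner_smul_right, norm_smul, Real.norm_of_nonneg ht0.le] at ht
    exact le_of_mul_le_mul_left (ht.trans_eq (by ring)) ht0
  have hlim : Tendsto (fun ε : ℝ => ε * ‖x' - x‖) (𝓝[>] 0) (𝓝 0) := by
    have : Continuous fun ε : ℝ => ε * ‖x' - x‖ := by fun_prop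
    simpa using (this.tendsto 0).mono_left nhdsWithin_le_nhds
  exact ge_of_tendsto hlim (eventually_mem_nhdsWithin.mono hbound)

theorem mem_regularNormalCone_of_inner_nonpos (hx : x ∈ C)
    (h : ∀ x' ∈ C, inner ℝ v (x' - x) ≤ 0) : v ∈ regularNormalCone C x :=
  ⟨hx, fun ε hε => eventually_mem_nhdsWithin.mono fun x' hx' => (h x' hx').trans (by positivity)⟩

theorem mem_normalCone_iff_mem_closure :
    v ∈ normalCone C x ↔
      x ∈ C ∧ (x, v) ∈ closure {p : E × E | p.2 ∈ regularNormalCone C p.1} := by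
  rw [mem_closure_iff_seq_limit]
  refine and_congr_right fun _ => ⟨?_, ?_⟩
  · rintro ⟨xs, vs, _, hxs, hvs, hreg⟩
    exact ⟨fun ν => (xs ν, vs ν), hreg, hxs.prodMk_nhds hvs⟩
  · rintro ⟨ps, hps, hlim⟩
    exact ⟨fun ν => (ps ν).1, fun ν => (ps ν).2, fun ν => (hps ν).1, hlim.fst_nhds,
      hlim.snd_nhds, hps⟩

theorem mem_normalCone_of_tendsto {xs vs : ℕ → E} (hx : x ∈ C) (hxs : Tendsto xs atTop (𝓝 x))
    (hvs : Tendsto vs atTop (𝓝 v)) (h : ∀ k, vs k ∈ normalCone C (xs k)) :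
    v ∈ normalCone C x :=
  mem_normalCone_iff_mem_closure.2 ⟨hx, isClosed_closure.mem_of_tendsto (hxs.prodMk_nhds hvs)
    (Eventually.of_forall fun k => (mem_normalCone_iff_mem_closure.1 (h k)).2)⟩

theorem mem_normalCone_iff_of_convex (hC : Convex ℝ C) :
    v ∈ normalCone C x ↔ x ∈ C ∧ ∀ x' ∈ C, inner ℝ v (x' - x) ≤ 0 := by
  constructor
  · rintro ⟨hx, xs, vs, _, hxs, hvs, hreg⟩
    exact ⟨hx, fun x' hx' => le_of_tendsto' (hvs.inner (tendsto_const_nhds.sub hxs)) fun ν =>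
      inner_nonpos_of_mem_regularNormalCone hC (hreg ν) hx'⟩
  · rintro ⟨hx, h⟩
    exact mem_normalCone_iff_mem_closure.2
      ⟨hx, subset_closure (mem_regularNormalCone_of_inner_nonpos hx h)⟩

theorem smul_mem_regularNormalCone {t : ℝ} (ht : 0 < t) (hv : v ∈ regularNormalCone C x) :
    t • v ∈ regularNormalCone C x := by
  refine ⟨hv.1, fun ε hε => ?_⟩
  filter_upwards [hv.2 (ε / t) (by positivity)] with x' hx'
  rw [real_inner_smul_left]
  calc t * inner ℝ v (x' - x) ≤ t * (ε / t * ‖x' - x‖) := by gcongr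
    _ = ε * ‖x' - x‖ := by field_simp

theorem smul_mem_normalCone {t : ℝ} (ht : 0 < t) (hv : v ∈ normalCone C x) :
    t • v ∈ normalCone C x := by
  obtain ⟨hx, xs, vs, hxC, hxs, hvs, hreg⟩ := hv
  exact ⟨hx, xs, fun ν => t • vs ν, hxC, hxs, hvs.const_smul t,
    fun ν => smul_mem_regularNormalCone ht (hreg ν)⟩

theorem mem_normalCone_of_setConverges
    (hconv : (Convex ℝ C ∧ ∀ ν, Convex ℝ (Cν ν)) ∨ ∀ ν, Cν ν = C) (hC : SetConverges Cν C)
    {xs vs : ℕ → E} (hxs : Tendsto xs atTop (𝓝 x)) (hvs : Tendsto vs atTop (𝓝 v))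
    (h : ∀ ν, vs ν ∈ normalCone (Cν ν) (xs ν)) : v ∈ normalCone C x := by
  have hx : x ∈ C := hC.mem_of_tendsto (fun ν => (h ν).1) hxs
  rcases hconv with ⟨hconvex, hconvexν⟩ | heq
  · refine (mem_normalCone_iff_of_convex hconvex).2 ⟨hx, fun x' hx' => ?_⟩
    obtain ⟨ws, hws, hwl⟩ := hC.2 hx'
    exact le_of_tendsto' (hvs.inner (hwl.sub hxs)) fun ν =>
      ((mem_normalCone_iff_of_convex (hconvexν ν)).1 (h ν)).2 _ (hws ν)
  · exact mem_normalCone_of_tendsto hx hxs hvs fun ν => heq ν ▸ h ν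

theorem exists_sub_mem_normalCone [CompleteSpace E] (hne : C.Nonempty) (hcl : IsClosed C)
    (hC : Convex ℝ C) (q : E) : ∃ p, q - p ∈ normalCone C p := by
  obtain ⟨p, hp, hmin⟩ := exists_norm_eq_iInf_of_complete_convex hne hcl.isComplete hC q
  exact ⟨p, (mem_normalCone_iff_of_convex hC).2
    ⟨hp, (norm_eq_iInf_iff_real_inner_le_zero hC hp).1 hmin⟩⟩

theorem norm_sub_sq_add_le_of_sub_mem_normalCone (hC : Convex ℝ C) {p q : E}
    (hp : q - p ∈ normalCone C p) (hx : x ∈ C) : ‖x - p‖ ^ 2 + ‖q - p‖ ^ 2 ≤ ‖q - x‖ ^ 2 := by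
  have hinner := ((mem_normalCone_iff_of_convex hC).1 hp).2 x hx
  rw [← sub_sub_sub_cancel_right q x p, norm_sub_sq_real (q - p) (x - p)]
  linarith

theorem tendsto_of_sub_mem_normalCone [ProperSpace E] (hC : Convex ℝ C)
    (hCν : ∀ ν, Convex ℝ (Cν ν)) (hlim : SetConverges Cν C) {p q : E} {ps : ℕ → E}
    (hp : q - p ∈ normalCone C p) (hps : ∀ ν, q - ps ν ∈ normalCone (Cν ν) (ps ν)) :
    Tendsto ps atTop (𝓝 p) := by
  obtain ⟨ws, hws, hwl⟩ := hlim.2 hp.1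
  have hle : ∀ ν, ‖q - ps ν‖ ≤ ‖q - ws ν‖ := fun ν => by
    have := norm_sub_sq_add_le_of_sub_mem_normalCone (hCν ν) (hps ν) (hws ν)
    exact le_of_sq_le_sq (by nlinarith [sq_nonneg ‖ws ν - ps ν‖]) (norm_nonneg _)
  have hwq : Tendsto (fun ν => ‖q - ws ν‖) atTop (𝓝 ‖q - p‖) := (hwl.const_sub q).norm
  obtain ⟨R, hR⟩ := hwq.bddAbove_range
  refine (isCompact_closedBall q R).tendsto_nhds_of_unique_mapClusterPt
    (Eventually.of_forall fun ν => mem_closedBall_iff_norm'.2 ((hle ν).trans (hR ⟨ν, rfl⟩)))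
    fun c _ hc => ?_
  have hcp := norm_sub_sq_add_le_of_sub_mem_normalCone hC hp
    (hlim.mem_of_mapClusterPt (fun ν => (hps ν).1) hc)
  obtain ⟨φ, hφ, hcl⟩ := hc.tendsto_subseq
  have hcq : ‖q - c‖ ≤ ‖q - p‖ := le_of_tendsto_of_tendsto' (hcl.const_sub q).norm
    (hwq.comp hφ.tendsto_atTop) fun k => hle (φ k)
  have hzero : ‖c - p‖ = 0 := by nlinarith [norm_nonneg (q - c), norm_nonneg (c - p)]
  exact sub_eq_zero.1 (norm_eq_zero.1 hzero)

-- The point `x` is the projection of `x + v` on `C`; project `x + v` on the sets `Cν ν`.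
theorem exists_tendsto_normalCone_of_convex [ProperSpace E] (hcl : ∀ ν, IsClosed (Cν ν))
    (hC : Convex ℝ C) (hCν : ∀ ν, Convex ℝ (Cν ν)) (hlim : SetConverges Cν C)
    (hv : v ∈ normalCone C x) :
    ∃ xs vs : ℕ → E, Tendsto xs atTop (𝓝 x) ∧ Tendsto vs atTop (𝓝 v) ∧
      ∀ ν, vs ν ∈ normalCone (Cν ν) (xs ν) := by
  obtain ⟨ws, hws, _⟩ := hlim.2 hv.1
  choose p hp using fun ν => exists_sub_mem_normalCone ⟨ws ν, hws ν⟩ (hcl ν) (hCν ν) (x + v)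
  have hpl : Tendsto p atTop (𝓝 x) :=
    tendsto_of_sub_mem_normalCone hC hCν hlim (by rwa [add_sub_cancel_left]) hp
  exact ⟨p, fun ν => x + v - p ν, hpl, by simpa using hpl.const_sub (x + v), hp⟩

theorem exists_tendsto_normalCone [ProperSpace E]
    (hconv : (Convex ℝ C ∧ ∀ ν, Convex ℝ (Cν ν)) ∨ ∀ ν, Cν ν = C) (hcl : ∀ ν, IsClosed (Cν ν))
    (hC : SetConverges Cν C) (hv : v ∈ normalCone C x) :
    ∃ xs vs : ℕ → E, Tendsto xs atTop (𝓝 x) ∧ Tendsto vs atTop (𝓝 v) ∧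
      ∀ ν, vs ν ∈ normalCone (Cν ν) (xs ν) := by
  rcases hconv with ⟨hconvex, hconvexν⟩ | heq
  · exact exists_tendsto_normalCone_of_convex hcl hconvex hconvexν hC hv
  · exact ⟨fun _ => x, fun _ => v, tendsto_const_nhds, tendsto_const_nhds,
      fun ν => (heq ν).symm ▸ hv⟩

end NormalCone

section Subdifferential

variable {m : ℕ} {h : Rn m → EReal} {hν : ℕ → Rn m → EReal} {y z : Rn m}

theorem inner_withLp_prod_real {E : Type*} [NormedAddCommGroup E] [InnerProductSpace ℝ E]
    (v p : WithLp 2 (E × ℝ)) : inner ℝ v p = inner ℝ v.fst p.fst + v.snd * p.snd := by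
  rw [WithLp.prod_inner_apply, RCLike.inner_apply, conj_trivial, mul_comm]
  rfl

theorem toLp_toReal_mem_epi (hbot : h z ≠ ⊥) (htop : h z ≠ ⊤) :
    WithLp.toLp 2 (z, (h z).toReal) ∈ epi h :=
  (EReal.coe_toReal htop hbot).ge

theorem ne_top_of_mem_epi {p : WithLp 2 (Rn m × ℝ)} (hp : p ∈ epi h) : h p.fst ≠ ⊤ :=
  ((show h p.fst ≤ (p.snd : EReal) from hp).trans_lt (EReal.coe_lt_top _)).ne

theorem convex_effDom (hh : ProperLscConvex h) : Convex ℝ (effDom h) := by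
  intro a ha b hb s t hs ht hst
  have hcomb := hh.epi_convex (toLp_toReal_mem_epi (hh.ne_bot a) (ne_of_lt ha))
    (toLp_toReal_mem_epi (hh.ne_bot b) (ne_of_lt hb)) hs ht hst
  exact (ne_top_of_mem_epi hcomb).lt_top

theorem mem_subdiff_iff_of_ne_top (hh : ProperLscConvex h) (htop : h z ≠ ⊤) :
    y ∈ subdiff h z ↔ ∀ p ∈ epi h, inner ℝ y (p.fst - z) ≤ p.snd - (h z).toReal := by
  have hbot := hh.ne_bot z
  simp only [subdiff, Set.mem_ofPred_eq, mem_normalCone_iff_of_convex hh.epi_convex, hbot, htop,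
    toLp_toReal_mem_epi hbot htop, ne_eq, not_false_eq_true, true_and, inner_withLp_prod_real,
    WithLp.sub_fst, WithLp.sub_snd, WithLp.toLp_fst, WithLp.toLp_snd, neg_one_mul,
    add_neg_le_iff_le_add, zero_add]

-- Quantifying over the reals below `h z` includes `h z = ⊤`, where the right-hand side fails.
theorem mem_subdiff_iff (hh : ProperLscConvex h) :
    y ∈ subdiff h z ↔
      ∀ c : ℝ, (c : EReal) < h z → ∀ p ∈ epi h, inner ℝ y (p.fst - z) ≤ p.snd - c := by
  by_cases htop : h z = ⊤
  · refine ⟨fun hy => absurd htop hy.2.1, fun hy => ?_⟩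
    obtain ⟨p, hp⟩ := hh.epi_nonempty
    have := hy (p.snd - inner ℝ y (p.fst - z) + 1) (htop ▸ EReal.coe_lt_top _) p hp
    linarith
  · rw [mem_subdiff_iff_of_ne_top hh htop, ← EReal.coe_toReal htop (hh.ne_bot z)]
    simp only [EReal.coe_lt_coe_iff, EReal.toReal_coe]
    refine ⟨fun hy c hc p hp => (hy p hp).trans (by linarith), fun hy p hp => ?_⟩
    have hsup : (h z).toReal ≤ p.snd - inner ℝ y (p.fst - z) :=
      le_of_forall_lt_imp_le_of_dense fun c hc => by linarith [hy c hc p hp]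
    linarith

theorem snd_nonpos_of_mem_normalCone_epi (hconv : Convex ℝ (epi h)) {p v : WithLp 2 (Rn m × ℝ)}
    (hv : v ∈ normalCone (epi h) p) : v.snd ≤ 0 := by
  obtain ⟨hp, hineq⟩ := (mem_normalCone_iff_of_convex hconv).1 hv
  have hup : WithLp.toLp 2 (p.fst, p.snd + 1) ∈ epi h :=
    (show h p.fst ≤ (p.snd : EReal) from hp).trans
      (EReal.coe_le_coe_iff.2 (le_add_of_nonneg_right zero_le_one))
  simpa [inner_withLp_prod_real] using hineq _ hup

theorem inv_smul_fst_mem_subdiff (hh : ProperLscConvex h) {p v : WithLp 2 (Rn m × ℝ)}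
    (hv : v ∈ normalCone (epi h) p) (hneg : v.snd < 0) :
    (-v.snd)⁻¹ • v.fst ∈ subdiff h p.fst := by
  obtain ⟨hp, hineq⟩ := (mem_normalCone_iff_of_convex hh.epi_convex).1 hv
  have htop := ne_top_of_mem_epi hp
  have hpos : 0 < -v.snd := neg_pos.2 hneg
  have hle : (h p.fst).toReal ≤ p.snd :=
    EReal.toReal_le_toReal hp (hh.ne_bot _) (EReal.coe_ne_top _)
  refine (mem_subdiff_iff_of_ne_top hh htop).2 fun q hq => ?_
  have hvq := hineq q hq
  rw [inner_withLp_prod_real, WithLp.sub_fst, WithLp.sub_snd] at hvq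
  rw [real_inner_smul_left, inv_mul_le_iff₀ hpos]
  nlinarith

theorem exists_mem_subdiff (hh : ProperLscConvex h) : ∃ z y : Rn m, y ∈ subdiff h z := by
  obtain ⟨p₀, hp₀⟩ := hh.epi_nonempty
  have htop := ne_top_of_mem_epi hp₀
  set z := p₀.fst
  -- A point strictly below the graph is separated from the epigraph by a non-vertical normal.
  obtain ⟨p, hv⟩ := exists_sub_mem_normalCone hh.epi_nonempty hh.epi_closed hh.epi_convex
    (WithLp.toLp 2 (z, (h z).toReal - 1))
  refine ⟨_, _, inv_smul_fst_mem_subdiff hh hv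
    ((snd_nonpos_of_mem_normalCone_epi hh.epi_convex hv).lt_of_ne fun hzero => ?_)⟩
  have hineq := ((mem_normalCone_iff_of_convex hh.epi_convex).1 hv).2 _
    (toLp_toReal_mem_epi (hh.ne_bot z) htop)
  rw [inner_withLp_prod_real, hzero, zero_mul, add_zero] at hineq
  have hzp : z = p.fst :=
    sub_eq_zero.1 (inner_self_eq_zero.1 (le_antisymm hineq real_inner_self_nonneg))
  have hsnd : (h z).toReal - 1 = p.snd := sub_eq_zero.1 hzero
  have hle : h z ≤ (p.snd : EReal) := hzp ▸ hv.1
  rw [← hsnd, ← EReal.coe_toReal htop (hh.ne_bot z), EReal.coe_le_coe_iff,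
    EReal.toReal_coe] at hle
  linarith

theorem exists_tendsto_subdiff (hh : ProperLscConvex h) (hhν : ∀ ν, ProperLscConvex (hν ν))
    (hb : EpiConverges hν h) (hy : y ∈ subdiff h z) :
    ∃ zs ys : ℕ → Rn m, Tendsto zs atTop (𝓝 z) ∧ Tendsto ys atTop (𝓝 y) ∧
      ∀ ν, ys ν ∈ subdiff (hν ν) (zs ν) := by
  obtain ⟨ps, vs, hps, hvs, hnormal⟩ := exists_tendsto_normalCone_of_convex
    (fun ν => (hhν ν).epi_closed) hh.epi_convex (fun ν => (hhν ν).epi_convex) hb hy.2.2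
  have hfst : Tendsto (fun ν => (vs ν).fst) atTop (𝓝 y) :=
    ((WithLp.prod_continuous_ofLp 2 _ _).fst.tendsto _).comp hvs
  have hsnd : Tendsto (fun ν => (vs ν).snd) atTop (𝓝 (-1)) :=
    ((WithLp.prod_continuous_ofLp 2 _ _).snd.tendsto _).comp hvs
  have hneg : ∀ᶠ ν in atTop, (vs ν).snd < 0 := hsnd.eventually_lt_const (by norm_num)
  have hsmul : Tendsto (fun ν => (-(vs ν).snd)⁻¹ • (vs ν).fst) atTop (𝓝 y) := by
    simpa using (hsnd.neg.inv₀ (by norm_num)).smul hfst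
  -- The finitely many indices with a non-downward normal get an arbitrary subgradient.
  choose z₀ y₀ hy₀ using fun ν => exists_mem_subdiff (hhν ν)
  refine ⟨fun ν => if (vs ν).snd < 0 then (ps ν).fst else z₀ ν,
    fun ν => if (vs ν).snd < 0 then (-(vs ν).snd)⁻¹ • (vs ν).fst else y₀ ν, ?_, ?_, fun ν => ?_⟩
  · exact (((WithLp.prod_continuous_ofLp 2 _ _).fst.tendsto _).comp hps).congr'
      (hneg.mono fun ν hν => (if_pos hν).symm)
  · exact hsmul.congr' (hneg.mono fun ν hν => (if_pos hν).symm)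
  · by_cases hν : (vs ν).snd < 0
    · simpa only [if_pos hν] using inv_smul_fst_mem_subdiff (hhν ν) (hnormal ν) hν
    · simpa only [if_neg hν] using hy₀ ν

theorem EpiConverges.eventually_lt (hb : EpiConverges hν h) {zs : ℕ → Rn m}
    (hzs : Tendsto zs atTop (𝓝 z)) {c : ℝ} (hc : (c : EReal) < h z) :
    ∀ᶠ ν in atTop, (c : EReal) < hν ν (zs ν) := by
  by_contra hcon
  obtain ⟨ψ, hψ, hle⟩ := extraction_of_frequently_atTop (not_eventually.1 hcon)
  have hlim : Tendsto (fun k => WithLp.toLp 2 (zs (ψ k), c)) atTop (𝓝 (WithLp.toLp 2 (z, c))) :=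
    ((WithLp.prod_continuous_toLp 2 _ _).tendsto _).comp
      ((hzs.comp hψ.tendsto_atTop).prodMk_nhds tendsto_const_nhds)
  have hmem : WithLp.toLp 2 (z, c) ∈ epi h := hb.1 ⟨ψ, hψ, _, fun k => not_lt.1 (hle k), hlim⟩
  exact absurd hc (not_lt.2 hmem)

-- With `τ = 1` this says that `y` is a subgradient, with `τ = 0` that it is normal to the domain.
theorem EpiConverges.inner_le_of_tendsto_smul (hb : EpiConverges hν h)
    (hhν : ∀ ν, ProperLscConvex (hν ν)) {zs ys : ℕ → Rn m} {t : ℕ → ℝ} {τ : ℝ}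
    (ht : ∀ ν, 0 ≤ t ν) (htl : Tendsto t atTop (𝓝 τ)) (hzs : Tendsto zs atTop (𝓝 z))
    (hys : Tendsto (fun ν => t ν • ys ν) atTop (𝓝 y)) (hsub : ∀ ν, ys ν ∈ subdiff (hν ν) (zs ν))
    {c : ℝ} (hc : (c : EReal) < h z) {p : WithLp 2 (Rn m × ℝ)} (hp : p ∈ epi h) :
    inner ℝ y (p.fst - z) ≤ τ * (p.snd - c) := by
  obtain ⟨ps, hps, hpl⟩ := hb.2 hp
  have hfst : Tendsto (fun ν => (ps ν).fst) atTop (𝓝 p.fst) :=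
    ((WithLp.prod_continuous_ofLp 2 _ _).fst.tendsto _).comp hpl
  have hsnd : Tendsto (fun ν => (ps ν).snd) atTop (𝓝 p.snd) :=
    ((WithLp.prod_continuous_ofLp 2 _ _).snd.tendsto _).comp hpl
  refine le_of_tendsto_of_tendsto (hys.inner (hfst.sub hzs)) (htl.mul (hsnd.sub_const c)) ?_
  filter_upwards [hb.eventually_lt hzs hc] with ν hcν
  rw [real_inner_smul_left]
  exact mul_le_mul_of_nonneg_left ((mem_subdiff_iff (hhν ν)).1 (hsub ν) c hcν _ (hps ν)) (ht ν)

theorem EpiConverges.mem_subdiff_of_tendsto (hb : EpiConverges hν h) (hh : ProperLscConvex h)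
    (hhν : ∀ ν, ProperLscConvex (hν ν)) {zs ys : ℕ → Rn m} (hzs : Tendsto zs atTop (𝓝 z))
    (hys : Tendsto ys atTop (𝓝 y)) (hsub : ∀ ν, ys ν ∈ subdiff (hν ν) (zs ν)) :
    y ∈ subdiff h z :=
  (mem_subdiff_iff hh).2 fun c hc p hp => by
    simpa using hb.inner_le_of_tendsto_smul hhν (fun _ => zero_le_one) tendsto_const_nhds hzs
      (by simpa using hys) hsub hc hp

theorem EpiConverges.mem_normalCone_effDom_of_tendsto (hb : EpiConverges hν h)
    (hh : ProperLscConvex h) (hhν : ∀ ν, ProperLscConvex (hν ν)) (hz : z ∈ effDom h)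
    {zs ys : ℕ → Rn m} {t : ℕ → ℝ} (ht : ∀ ν, 0 ≤ t ν) (htl : Tendsto t atTop (𝓝 0))
    (hzs : Tendsto zs atTop (𝓝 z)) (hys : Tendsto (fun ν => t ν • ys ν) atTop (𝓝 y))
    (hsub : ∀ ν, ys ν ∈ subdiff (hν ν) (zs ν)) : y ∈ normalCone (effDom h) z := by
  refine (mem_normalCone_iff_of_convex (convex_effDom hh)).2 ⟨hz, fun w hw => ?_⟩
  obtain ⟨c, _, hc⟩ := EReal.lt_iff_exists_real_btwn.1 (bot_lt_iff_ne_bot.2 (hh.ne_bot z))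
  simpa using hb.inner_le_of_tendsto_smul hhν ht htl hzs hys hsub hc
    (toLp_toReal_mem_epi (hh.ne_bot w) (ne_of_lt hw))

end Subdifferential

theorem exists_subseq_tendsto_inv_norm_smul {E : Type*} [NormedAddCommGroup E] [NormedSpace ℝ E]
    [ProperSpace E] {ys : ℕ → E} (hys : Tendsto (fun ν => ‖ys ν‖) atTop atTop) :
    ∃ (φ : ℕ → ℕ) (u : E), StrictMono φ ∧ ‖u‖ = 1 ∧ (∀ k, 0 < ‖ys (φ k)‖) ∧
      Tendsto (fun k => ‖ys (φ k)‖⁻¹ • ys (φ k)) atTop (𝓝 u) := by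
  obtain ⟨N, hN⟩ := eventually_atTop.1 (hys.eventually_gt_atTop 0)
  have hpos : ∀ k, 0 < ‖ys (k + N)‖ := fun k => hN _ (Nat.le_add_left N k)
  obtain ⟨u, hu, φ, hφ, hlim⟩ := (isCompact_sphere (0 : E) 1).tendsto_subseq
    (x := fun k => ‖ys (k + N)‖⁻¹ • ys (k + N)) fun k => by
      rw [mem_sphere_zero_iff_norm, norm_smul, norm_inv, norm_norm, inv_mul_cancel₀ (hpos k).ne']
  exact ⟨fun k => φ k + N, u, hφ.add_const N, mem_sphere_zero_iff_norm.1 hu,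
    fun k => hpos (φ k), hlim⟩

section MultiplierSet

variable {n m : ℕ} {X : Set (Rn n)} {Xν : ℕ → Set (Rn n)} {D : Fin m → Rn n → Set (Rn n)}
  {Dν : ℕ → Fin m → Rn n → Set (Rn n)} {x u : Rn n} {y : Rn m}

theorem mem_multiplierSet_iff :
    u ∈ multiplierSet X D x y ↔ ∃ d : Fin m → Rn n, (∀ i, d i ∈ convexHull ℝ (D i x)) ∧
      ∃ v ∈ normalCone X x, ∑ i, y i • d i + v = u := by
  rw [multiplierSet, Set.mem_add]
  constructor
  · rintro ⟨a, ha, v, hv, rfl⟩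
    obtain ⟨g, hg, rfl⟩ := (Set.mem_fintype_sum _ _).1 ha
    choose d hd hdg using fun i => Set.mem_smul_set.1 (hg i)
    exact ⟨d, hd, v, hv, by simp only [hdg]⟩
  · rintro ⟨d, hd, v, hv, rfl⟩
    exact ⟨_, (Set.mem_fintype_sum _ _).2 ⟨fun i => y i • d i,
      fun i => Set.smul_mem_smul_set (hd i), rfl⟩, v, hv, rfl⟩

theorem mem_of_mem_multiplierSet (hu : u ∈ multiplierSet X D x y) : x ∈ X := by
  obtain ⟨_, _, v, hv, _⟩ := mem_multiplierSet_iff.1 hu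
  exact hv.1

theorem smul_mem_multiplierSet {t : ℝ} (ht : 0 < t) (hu : u ∈ multiplierSet X D x y) :
    t • u ∈ multiplierSet X D x (t • y) := by
  obtain ⟨d, hd, v, hv, rfl⟩ := mem_multiplierSet_iff.1 hu
  refine mem_multiplierSet_iff.2 ⟨d, hd, t • v, smul_mem_normalCone ht hv, ?_⟩
  simp only [PiLp.smul_apply, smul_eq_mul, mul_smul, smul_add, Finset.smul_sum]

theorem tendsto_sum_smul {ι E : Type*} [Fintype ι] [TopologicalSpace E] [AddCommMonoid E]
    [Module ℝ E] [ContinuousAdd E] [ContinuousSMul ℝ E] {α : Type*} {l : Filter α}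
    {ys : α → EuclideanSpace ℝ ι} {y : EuclideanSpace ℝ ι} {ds : α → ι → E} {d : ι → E}
    (hys : Tendsto ys l (𝓝 y)) (hds : Tendsto ds l (𝓝 d)) :
    Tendsto (fun a => ∑ i, ys a i • ds a i) l (𝓝 (∑ i, y i • d i)) :=
  tendsto_finsetSum _ fun i _ =>
    (((EuclideanSpace.proj (𝕜 := ℝ) i).continuous.tendsto y).comp hys).smul (hds.apply_nhds i)

theorem mem_multiplierSet_of_tendsto
    (hconv : (Convex ℝ X ∧ ∀ ν, Convex ℝ (Xν ν)) ∨ ∀ ν, Xν ν = X) (hX : SetConverges Xν X)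
    (hD : ∀ i, OuterConvergesBoundedly Xν (fun ν => Dν ν i) fun x => convexHull ℝ (D i x))
    {xs us : ℕ → Rn n} {ys : ℕ → Rn m} (hxs : Tendsto xs atTop (𝓝 x))
    (hys : Tendsto ys atTop (𝓝 y)) (hus : Tendsto us atTop (𝓝 u))
    (hmem : ∀ ν, us ν ∈ multiplierSet (Xν ν) (Dν ν) (xs ν) (ys ν)) :
    u ∈ multiplierSet X D x y := by
  choose ds hds vs hvs heq using fun ν => mem_multiplierSet_iff.1 (hmem ν)
  obtain ⟨ψ, d, hψ, hd, hdl⟩ := OuterConvergesBoundedly.exists_subseq_tendsto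
    (fun i => (hD i).convexHull fun x => convex_convexHull ℝ (D i x)) (fun ν => (hvs ν).1) hxs hds
  have hψl := hψ.tendsto_atTop
  have hvl : Tendsto (vs ∘ ψ) atTop (𝓝 (u - ∑ i, y i • d i)) :=
    ((hus.comp hψl).sub (tendsto_sum_smul (hys.comp hψl) hdl)).congr fun k =>
      sub_eq_of_eq_add' (heq (ψ k)).symm
  have hv : u - ∑ i, y i • d i ∈ normalCone X x :=
    mem_normalCone_of_setConverges (hconv.imp (And.imp_right fun h k => h (ψ k)) fun h k => h (ψ k))
      (hX.comp_strictMono hψ) (hxs.comp hψl) hvl fun k => hvs (ψ k)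
  exact mem_multiplierSet_iff.2 ⟨d, hd, _, hv, add_sub_cancel _ _⟩

end MultiplierSet

section NearStationary

variable {n m : ℕ} {X : Set (Rn n)} {f₀ : Rn n → ℝ} {h : Rn m → EReal} {F : Rn n → Rn m}
  {D : Fin m → Rn n → Set (Rn n)} {x : Rn n} {y z : Rn m}

theorem mem_statMap_iff {s : Rn m × Rn m × Rn n} :
    s ∈ statMap X f₀ h F D x y z ↔ s.1 = F x - z ∧ s.2.1 + y ∈ subdiff h z ∧
      s.2.2 - ∇ f₀ x ∈ multiplierSet X D x y := by
  simp only [statMap, Set.mem_prod, Set.mem_singleton_iff, Set.sub_singleton, Set.mem_image,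
    Set.singleton_add, sub_eq_iff_eq_add, exists_eq_right, ← eq_sub_iff_add_eq']

theorem zero_mem_statMap_iff :
    0 ∈ statMap X f₀ h F D x y z ↔ F x = z ∧ y ∈ subdiff h z ∧
      -∇ f₀ x ∈ multiplierSet X D x y := by
  rw [mem_statMap_iff, Prod.fst_zero, Prod.snd_zero, Prod.fst_zero, Prod.snd_zero, zero_add,
    zero_sub, eq_comm, sub_eq_zero]

theorem exists_mem_norm_le_of_distZero_le {C : Set (Rn m × Rn m × Rn n)} {ε δ : ℝ} (hε : 0 ≤ ε)
    (hδ : 0 < δ) (h : distZero C ≤ ENNReal.ofReal ε) : ∃ s ∈ C, ‖s‖ ≤ ε + δ := by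
  have hlt : distZero C < ENNReal.ofReal (ε + δ) :=
    h.trans_lt ((ENNReal.ofReal_lt_ofReal_iff (by linarith)).2 (by linarith))
  simp only [distZero, iInf_lt_iff] at hlt
  obtain ⟨s, hs, hlt⟩ := hlt
  have hle := ((ENNReal.ofReal_lt_ofReal_iff (by linarith)).1 hlt).le
  refine ⟨s, hs, norm_prod_le_iff.2 ⟨?_, norm_prod_le_iff.2 ⟨?_, ?_⟩⟩⟩ <;>
    refine le_trans (Real.le_sqrt_of_sq_le ?_) hle <;>
    linarith [sq_nonneg ‖s.1‖, sq_nonneg ‖s.2.1‖, sq_nonneg ‖s.2.2‖]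

variable {Sν : ℕ → Rn n → Rn m → Rn m → Set (Rn m × Rn m × Rn n)} {xs : ℕ → Rn n}
  {ys zs : ℕ → Rn m}

theorem NearStationary.exists_tendsto_zero {ε : ℕ → ℝ} (hS : NearStationary Sν ε xs ys zs) :
    ∃ s : ℕ → Rn m × Rn m × Rn n, (∀ ν, s ν ∈ Sν ν (xs ν) (ys ν) (zs ν)) ∧
      Tendsto s atTop (𝓝 0) := by
  obtain ⟨hε, hεl, hdist⟩ := hS
  choose s hs hle using fun ν =>
    exists_mem_norm_le_of_distZero_le (hε ν) (Nat.one_div_pos_of_nat (α := ℝ) (n := ν)) (hdist ν)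
  exact ⟨s, hs, squeeze_zero_norm hle
    (by simpa using hεl.add tendsto_one_div_add_atTop_nhds_zero_nat)⟩

theorem exists_nearStationary_of_tendsto_zero {s : ℕ → Rn m × Rn m × Rn n}
    (hs : ∀ ν, s ν ∈ Sν ν (xs ν) (ys ν) (zs ν)) (hsl : Tendsto s atTop (𝓝 0)) :
    ∃ ε, NearStationary Sν ε xs ys zs := by
  refine ⟨fun ν => √(‖(s ν).1‖ ^ 2 + ‖(s ν).2.1‖ ^ 2 + ‖(s ν).2.2‖ ^ 2),
    fun ν => Real.sqrt_nonneg _, ?_, fun ν => iInf₂_le (s ν) (hs ν)⟩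
  have hcont : Continuous fun s : Rn m × Rn m × Rn n =>
      √(‖s.1‖ ^ 2 + ‖s.2.1‖ ^ 2 + ‖s.2.2‖ ^ 2) := by fun_prop
  simpa [Function.comp_def] using (hcont.tendsto 0).comp hsl

end NearStationary

section CompositeProblem

/-- The data of the problem of minimizing `f₀ + h ∘ F` over `X`, where the set-valued mapping `D i`
stands in for a generalized gradient of the `i`-th component of `F`. -/
structure CompositeProblem (n m : ℕ) where
  X : Set (Rn n)
  f₀ : Rn n → ℝ
  h : Rn m → EReal
  F : Rn n → Rn m
  D : Fin m → Rn n → Set (Rn n)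

/-- The set-valued mapping `S` of the problem, whose zeros are its stationary points. -/
abbrev CompositeProblem.statMap {n m : ℕ} (P : CompositeProblem n m) :
    Rn n → Rn m → Rn m → Set (Rn m × Rn m × Rn n) :=
  GlobalApprox.statMap P.X P.f₀ P.h P.F P.D

/-- Convergence of the problems `Pν ν` to `P` in the sense of assumptions (a)–(d), for nonempty
values of the mappings `D`. -/
structure ProblemsConverge {n m : ℕ} (Pν : ℕ → CompositeProblem n m) (P : CompositeProblem n m) :
    Prop where
  convex_or_const : (Convex ℝ P.X ∧ ∀ ν, Convex ℝ (Pν ν).X) ∨ ∀ ν, (Pν ν).X = P.X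
  setConverges : SetConverges (fun ν => (Pν ν).X) P.X
  properLscConvex : ProperLscConvex P.h
  properLscConvex_approx : ∀ ν, ProperLscConvex (Pν ν).h
  epiConverges : EpiConverges (fun ν => (Pν ν).h) P.h
  gradient : ContinuouslyConverges (fun ν => (Pν ν).X) (fun ν => ∇ (Pν ν).f₀) (∇ P.f₀)
  inner_map : ContinuouslyConverges (fun ν => (Pν ν).X) (fun ν => (Pν ν).F) P.F
  generalized_gradient : ∀ i, OuterConvergesBoundedly (fun ν => (Pν ν).X) (fun ν => (Pν ν).D i)
    fun x => convexHull ℝ (P.D i x)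
  nonempty : ∀ ν i, ∀ x ∈ (Pν ν).X, ((Pν ν).D i x).Nonempty

variable {n m : ℕ} {P : CompositeProblem n m} {Pν : ℕ → CompositeProblem n m} {x : Rn n}
  {y z : Rn m} {xs : ℕ → Rn n} {ys zs : ℕ → Rn m} {s : ℕ → Rn m × Rn m × Rn n}

namespace ProblemsConverge

theorem comp_strictMono (hP : ProblemsConverge Pν P) {φ : ℕ → ℕ} (hφ : StrictMono φ) :
    ProblemsConverge (Pν ∘ φ) P where
  convex_or_const :=
    hP.convex_or_const.imp (And.imp_right fun h k => h (φ k)) fun h k => h (φ k)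
  setConverges := hP.setConverges.comp_strictMono hφ
  properLscConvex := hP.properLscConvex
  properLscConvex_approx k := hP.properLscConvex_approx (φ k)
  epiConverges := SetConverges.comp_strictMono hP.epiConverges hφ
  gradient := hP.gradient.comp_strictMono hP.setConverges hφ
  inner_map := hP.inner_map.comp_strictMono hP.setConverges hφ
  generalized_gradient i := (hP.generalized_gradient i).comp_strictMono hP.setConverges
    (fun ν => hP.nonempty ν i) hφ
  nonempty k := hP.nonempty (φ k)

theorem tendsto_of_mem_statMap (hP : ProblemsConverge Pν P)
    (hs : ∀ ν, s ν ∈ (Pν ν).statMap (xs ν) (ys ν) (zs ν)) (hsl : Tendsto s atTop (𝓝 0))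
    (hxs : Tendsto xs atTop (𝓝 x)) : Tendsto zs atTop (𝓝 (P.F x)) := by
  have hmem : ∀ ν, xs ν ∈ (Pν ν).X := fun ν =>
    mem_of_mem_multiplierSet (mem_statMap_iff.1 (hs ν)).2.2
  have hlim := (hP.inner_map x xs hmem hxs).sub hsl.fst_nhds
  rw [Prod.fst_zero, sub_zero] at hlim
  refine hlim.congr fun ν => ?_
  rw [(mem_statMap_iff.1 (hs ν)).1, sub_sub_cancel]

theorem tendsto_sub_gradient (hP : ProblemsConverge Pν P)
    (hs : ∀ ν, s ν ∈ (Pν ν).statMap (xs ν) (ys ν) (zs ν)) (hsl : Tendsto s atTop (𝓝 0))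
    (hxs : Tendsto xs atTop (𝓝 x)) :
    Tendsto (fun ν => (s ν).2.2 - ∇ (Pν ν).f₀ (xs ν)) atTop (𝓝 (-∇ P.f₀ x)) := by
  have hmem : ∀ ν, xs ν ∈ (Pν ν).X := fun ν =>
    mem_of_mem_multiplierSet (mem_statMap_iff.1 (hs ν)).2.2
  simpa using hsl.snd_nhds.snd_nhds.sub (hP.gradient x xs hmem hxs)

theorem zero_mem_statMap_of_tendsto (hP : ProblemsConverge Pν P)
    (hs : ∀ ν, s ν ∈ (Pν ν).statMap (xs ν) (ys ν) (zs ν)) (hsl : Tendsto s atTop (𝓝 0))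
    (hxs : Tendsto xs atTop (𝓝 x)) (hys : Tendsto ys atTop (𝓝 y)) :
    0 ∈ P.statMap x y (P.F x) := by
  have hsub : Tendsto (fun ν => (s ν).2.1 + ys ν) atTop (𝓝 y) := by
    simpa using hsl.snd_nhds.fst_nhds.add hys
  refine zero_mem_statMap_iff.2 ⟨rfl, ?_, ?_⟩
  · exact hP.epiConverges.mem_subdiff_of_tendsto hP.properLscConvex hP.properLscConvex_approx
      (hP.tendsto_of_mem_statMap hs hsl hxs) hsub fun ν => (mem_statMap_iff.1 (hs ν)).2.1
  · exact mem_multiplierSet_of_tendsto hP.convex_or_const hP.setConverges hP.generalized_gradient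
      hxs hys (hP.tendsto_sub_gradient hs hsl hxs) fun ν => (mem_statMap_iff.1 (hs ν)).2.2

theorem horizon_multiplier_of_tendsto_smul (hP : ProblemsConverge Pν P) {t : ℕ → ℝ}
    (ht : ∀ ν, 0 < t ν) (htl : Tendsto t atTop (𝓝 0))
    (hs : ∀ ν, s ν ∈ (Pν ν).statMap (xs ν) (ys ν) (zs ν)) (hsl : Tendsto s atTop (𝓝 0))
    (hxs : Tendsto xs atTop (𝓝 x)) (hys : Tendsto (fun ν => t ν • ys ν) atTop (𝓝 y)) :
    0 ∈ multiplierSet P.X P.D x y ∧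
      (P.F x ∈ effDom P.h → y ∈ normalCone (effDom P.h) (P.F x)) := by
  have hsub : Tendsto (fun ν => t ν • ((s ν).2.1 + ys ν)) atTop (𝓝 y) := by
    simpa [smul_add] using (htl.smul hsl.snd_nhds.fst_nhds).add hys
  have hmult : Tendsto (fun ν => t ν • ((s ν).2.2 - ∇ (Pν ν).f₀ (xs ν))) atTop (𝓝 0) := by
    simpa using htl.smul (hP.tendsto_sub_gradient hs hsl hxs)
  refine ⟨?_, fun hdom => ?_⟩
  · exact mem_multiplierSet_of_tendsto hP.convex_or_const hP.setConverges hP.generalized_gradient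
      hxs hys hmult fun ν => smul_mem_multiplierSet (ht ν) (mem_statMap_iff.1 (hs ν)).2.2
  · exact hP.epiConverges.mem_normalCone_effDom_of_tendsto hP.properLscConvex
      hP.properLscConvex_approx hdom (fun ν => (ht ν).le) htl
      (hP.tendsto_of_mem_statMap hs hsl hxs) hsub fun ν => (mem_statMap_iff.1 (hs ν)).2.1

theorem exists_horizon_multiplier (hP : ProblemsConverge Pν P)
    (hs : ∀ ν, s ν ∈ (Pν ν).statMap (xs ν) (ys ν) (zs ν)) (hsl : Tendsto s atTop (𝓝 0))
    (hxs : Tendsto xs atTop (𝓝 x)) (hys : Tendsto (fun ν => ‖ys ν‖) atTop atTop) :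
    ∃ u : Rn m, u ≠ 0 ∧ 0 ∈ multiplierSet P.X P.D x u ∧
      (P.F x ∈ effDom P.h → u ∈ normalCone (effDom P.h) (P.F x)) := by
  obtain ⟨φ, u, hφ, hu, hpos, hul⟩ := exists_subseq_tendsto_inv_norm_smul hys
  have hφl := hφ.tendsto_atTop
  exact ⟨u, ne_zero_of_norm_ne_zero (hu ▸ one_ne_zero),
    (hP.comp_strictMono hφ).horizon_multiplier_of_tendsto_smul
      (fun k => inv_pos.2 (hpos k)) (hys.comp hφl).inv_tendsto_atTop (fun k => hs (φ k))
      (hsl.comp hφl) (hxs.comp hφl) hul⟩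

theorem exists_zero_mem_statMap_of_tendsto (hP : ProblemsConverge Pν P)
    (hs : ∀ ν, s ν ∈ (Pν ν).statMap (xs ν) (ys ν) (zs ν)) (hsl : Tendsto s atTop (𝓝 0))
    (hxs : Tendsto xs atTop (𝓝 x))
    (hfeas : P.F x ∈ effDom P.h → BasicQualification P.X P.h P.F P.D x)
    (hinfeas : P.F x ∉ effDom P.h → InfeasQualification P.X P.D x) :
    ∃ y, 0 ∈ P.statMap x y (P.F x) := by
  by_cases hys : Tendsto (fun ν => ‖ys ν‖) atTop atTop
  · obtain ⟨u, hu, hmult, hnormal⟩ := hP.exists_horizon_multiplier hs hsl hxs hys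
    by_cases hdom : P.F x ∈ effDom P.h
    · exact absurd (hfeas hdom u (hnormal hdom) hmult) hu
    · exact absurd (hinfeas hdom u hmult) hu
  · obtain ⟨R, hR⟩ : ∃ R, ∃ᶠ ν in atTop, ys ν ∈ Metric.ball 0 R := by
      simpa only [tendsto_atTop, not_forall, not_eventually, not_le, mem_ball_zero_iff] using hys
    obtain ⟨y, _, φ, hφ, hyl⟩ := tendsto_subseq_of_frequently_bounded Metric.isBounded_ball hR
    have hφl := hφ.tendsto_atTop
    exact ⟨y, (hP.comp_strictMono hφ).zero_mem_statMap_of_tendsto (fun k => hs (φ k))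
      (hsl.comp hφl) (hxs.comp hφl) hyl⟩

theorem exists_zero_mem_statMap (hP : ProblemsConverge Pν P) {ε : ℕ → ℝ}
    (hS : NearStationary (fun ν => (Pν ν).statMap) ε xs ys zs) {φ : ℕ → ℕ} (hφ : StrictMono φ)
    (hxs : Tendsto (xs ∘ φ) atTop (𝓝 x))
    (hfeas : P.F x ∈ effDom P.h → BasicQualification P.X P.h P.F P.D x)
    (hinfeas : P.F x ∉ effDom P.h → InfeasQualification P.X P.D x) :
    ∃ y z, 0 ∈ P.statMap x y z := by
  obtain ⟨s, hs, hsl⟩ := hS.exists_tendsto_zero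
  obtain ⟨y, hy⟩ := (hP.comp_strictMono hφ).exists_zero_mem_statMap_of_tendsto
    (fun k => hs (φ k)) (hsl.comp hφ.tendsto_atTop) hxs hfeas hinfeas
  exact ⟨y, _, hy⟩

theorem zero_mem_statMap_of_mapClusterPt (hP : ProblemsConverge Pν P) {ε : ℕ → ℝ}
    (hS : NearStationary (fun ν => (Pν ν).statMap) ε xs ys zs)
    (hcluster : MapClusterPt (x, y, z) atTop fun ν => (xs ν, ys ν, zs ν)) :
    0 ∈ P.statMap x y z := by
  obtain ⟨s, hs, hsl⟩ := hS.exists_tendsto_zero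
  obtain ⟨φ, hφ, hlim⟩ := hcluster.tendsto_subseq
  have hPφ := hP.comp_strictMono hφ
  have hsφ := hsl.comp hφ.tendsto_atTop
  have hz : z = P.F x := tendsto_nhds_unique hlim.snd_nhds.snd_nhds
    (hPφ.tendsto_of_mem_statMap (fun k => hs (φ k)) hsφ hlim.fst_nhds)
  rw [hz]
  exact hPφ.zero_mem_statMap_of_tendsto (fun k => hs (φ k)) hsφ hlim.fst_nhds
    hlim.snd_nhds.fst_nhds

end ProblemsConverge

theorem exists_tendsto_nearStationary (hh : ProperLscConvex P.h)
    (hhν : ∀ ν, ProperLscConvex (Pν ν).h) (hb : EpiConverges (fun ν => (Pν ν).h) P.h)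
    (hz : P.F x = z) (hy : y ∈ subdiff P.h z) {d : Fin m → Rn n} {v : Rn n}
    (hzero : ∑ i, y i • d i + v = -∇ P.f₀ x) {vs : ℕ → Rn n} {ds : ℕ → Fin m → Rn n}
    (hvs : ∀ ν, vs ν ∈ normalCone (Pν ν).X (xs ν))
    (hds : ∀ ν i, ds ν i ∈ convexHull ℝ ((Pν ν).D i (xs ν))) (hxs : Tendsto xs atTop (𝓝 x))
    (hvl : Tendsto vs atTop (𝓝 v)) (hdl : Tendsto ds atTop (𝓝 d))
    (hF : Tendsto (fun ν => (Pν ν).F (xs ν)) atTop (𝓝 (P.F x)))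
    (hgrad : Tendsto (fun ν => ∇ (Pν ν).f₀ (xs ν)) atTop (𝓝 (∇ P.f₀ x))) :
    ∃ (xs : ℕ → Rn n) (ys zs : ℕ → Rn m) (ε : ℕ → ℝ),
      Tendsto (fun ν => (xs ν, ys ν, zs ν)) atTop (𝓝 (x, y, z)) ∧
        NearStationary (fun ν => (Pν ν).statMap) ε xs ys zs := by
  obtain ⟨zs, ys, hzl, hyl, hsub⟩ := exists_tendsto_subdiff hh hhν hb hy
  have hfst : Tendsto (fun ν => (Pν ν).F (xs ν) - zs ν) atTop (𝓝 0) := by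
    simpa [hz] using hF.sub hzl
  have hmult : Tendsto (fun ν => ∑ i, ys ν i • ds ν i + vs ν + ∇ (Pν ν).f₀ (xs ν)) atTop
      (𝓝 0) := by
    simpa [hzero] using ((tendsto_sum_smul hyl hdl).add hvl).add hgrad
  obtain ⟨ε, hε⟩ := exists_nearStationary_of_tendsto_zero
    (Sν := fun ν => (Pν ν).statMap) (xs := xs) (ys := ys) (zs := zs)
    (s := fun ν => ((Pν ν).F (xs ν) - zs ν, 0, ∑ i, ys ν i • ds ν i + vs ν + ∇ (Pν ν).f₀ (xs ν)))
    (fun ν => mem_statMap_iff.2 ⟨rfl, by simpa using hsub ν, by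
      rw [add_sub_cancel_right]
      exact mem_multiplierSet_iff.2 ⟨ds ν, hds ν, vs ν, hvs ν, rfl⟩⟩)
    (hfst.prodMk_nhds (tendsto_const_nhds.prodMk_nhds hmult))
  exact ⟨xs, ys, zs, ε, hxs.prodMk_nhds (hyl.prodMk_nhds hzl), hε⟩

theorem ProblemsConverge.zerosApproximable_of_subsingleton (hP : ProblemsConverge Pν P)
    (hcl : ∀ ν, IsClosed (Pν ν).X) (hD : ∀ i x, (P.D i x).Subsingleton) :
    ZerosApproximable P.statMap fun ν => (Pν ν).statMap := by
  intro x y z hzero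
  obtain ⟨hz, hy, hmult⟩ := zero_mem_statMap_iff.1 hzero
  obtain ⟨d, hd, v, hv, hsum⟩ := mem_multiplierSet_iff.1 hmult
  obtain ⟨xs, vs, hxs, hvl, hvs⟩ :=
    exists_tendsto_normalCone hP.convex_or_const hcl hP.setConverges hv
  have hmem : ∀ ν, xs ν ∈ (Pν ν).X := fun ν => (hvs ν).1
  choose ds hds using fun ν i => hP.nonempty ν i (xs ν) (hmem ν)
  have hdl : Tendsto ds atTop (𝓝 d) := tendsto_pi_nhds.2 fun i =>
    (hP.generalized_gradient i).tendsto_of_subsingleton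
      (by rw [(hD i x).convex.convexHull_eq]; exact hD i x) (hd i) hmem hxs fun ν => hds ν i
  exact exists_tendsto_nearStationary hP.properLscConvex hP.properLscConvex_approx hP.epiConverges
    hz hy hsum hvs (fun ν i => subset_convexHull ℝ _ (hds ν i)) hxs hvl hdl
    (hP.inner_map x xs hmem hxs) (hP.gradient x xs hmem hxs)

theorem zerosApproximable_of_const (hh : ProperLscConvex P.h)
    (hhν : ∀ ν, ProperLscConvex (Pν ν).h) (hb : EpiConverges (fun ν => (Pν ν).h) P.h)
    (hgrad : ∀ x ∈ P.X, Tendsto (fun ν => ∇ (Pν ν).f₀ x) atTop (𝓝 (∇ P.f₀ x)))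
    (hX : ∀ ν, (Pν ν).X = P.X) (hF : ∀ ν, (Pν ν).F = P.F) (hD : ∀ ν i, (Pν ν).D i = P.D i) :
    ZerosApproximable P.statMap fun ν => (Pν ν).statMap := by
  intro x y z hzero
  obtain ⟨hz, hy, hmult⟩ := zero_mem_statMap_iff.1 hzero
  obtain ⟨d, hd, v, hv, hsum⟩ := mem_multiplierSet_iff.1 hmult
  exact exists_tendsto_nearStationary hh hhν hb hz hy hsum (fun ν => (hX ν).symm ▸ hv)
    (fun ν i => (hD ν i).symm ▸ hd i) tendsto_const_nhds tendsto_const_nhds tendsto_const_nhds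
    (by simpa only [hF] using tendsto_const_nhds) (hgrad x hv.1)

end CompositeProblem

end GlobalApprox

theorem mainTheorem1_general {n m : ℕ} (P : CompositeProblem n m) (Pν : ℕ → CompositeProblem n m)
    (hXν : ∀ ν, IsClosed (Pν ν).X)
    (hconv : (Convex ℝ P.X ∧ ∀ ν, Convex ℝ (Pν ν).X) ∨ ∀ ν, (Pν ν).X = P.X)
    (hh : ProperLscConvex P.h) (hhν : ∀ ν, ProperLscConvex (Pν ν).h)
    (_hf₀ : Differentiable ℝ P.f₀) (_hf₀ν : ∀ ν, Differentiable ℝ (Pν ν).f₀)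
    (ha : SetConverges (fun ν => (Pν ν).X) P.X) (hb : EpiConverges (fun ν => (Pν ν).h) P.h)
    (hc : ContinuouslyConverges (fun ν => (Pν ν).X) (fun ν => ∇ (Pν ν).f₀) (∇ P.f₀))
    (hd : ∀ (i : Fin m) (x : Rn n) (xs vs : ℕ → Rn n),
      (∀ ν, xs ν ∈ (Pν ν).X) → Tendsto xs atTop (𝓝 x) → (∀ ν, vs ν ∈ (Pν ν).D i (xs ν)) →
      Tendsto (fun ν => (Pν ν).F (xs ν) i) atTop (𝓝 (P.F x i)) ∧
      Bornology.IsBounded (Set.range vs) ∧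
      ∀ v, MapClusterPt v atTop vs → v ∈ convexHull ℝ (P.D i x)) :
    ((∀ ν i, ∀ x ∈ (Pν ν).X, ((Pν ν).D i x).Nonempty) →
      (∀ (ε : ℕ → ℝ) (x : ℕ → Rn n) (y z : ℕ → Rn m),
        NearStationary (fun ν => (Pν ν).statMap) ε x y z →
        (∀ (φ : ℕ → ℕ) (xb : Rn n), StrictMono φ → Tendsto (x ∘ φ) atTop (𝓝 xb) →
          (P.F xb ∈ effDom P.h → BasicQualification P.X P.h P.F P.D xb) →
          (P.F xb ∉ effDom P.h → InfeasQualification P.X P.D xb) →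
          ∃ yb zb : Rn m, 0 ∈ P.statMap xb yb zb) ∧
        ∀ (xb : Rn n) (yb zb : Rn m),
          MapClusterPt (xb, yb, zb) atTop (fun ν => (x ν, y ν, z ν)) → 0 ∈ P.statMap xb yb zb) ∧
      ((∀ i x, (P.D i x).Subsingleton) →
        ZerosApproximable P.statMap fun ν => (Pν ν).statMap)) ∧
    ((∀ ν, (Pν ν).X = P.X) → (∀ ν, (Pν ν).F = P.F) → (∀ ν i, (Pν ν).D i = P.D i) →
      ZerosApproximable P.statMap fun ν => (Pν ν).statMap) := by
  refine ⟨fun hne => ?_, fun hX hF hD => ?_⟩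
  · have hP : ProblemsConverge Pν P :=
      { convex_or_const := hconv, setConverges := ha, properLscConvex := hh
        properLscConvex_approx := hhν, epiConverges := hb, gradient := hc
        inner_map := fun x xs hxs hlim => by
          choose vs hvs using fun ν i => hne ν i (xs ν) (hxs ν)
          exact ((PiLp.continuous_toLp 2 fun _ : Fin m => ℝ).tendsto (P.F x).ofLp).comp
            (tendsto_pi_nhds.2 fun i => (hd i x xs _ hxs hlim fun ν => hvs ν i).1)
        generalized_gradient := fun i x xs vs hxs hlim hvs => (hd i x xs vs hxs hlim hvs).2
        nonempty := hne }
    exact ⟨fun ε x y z hS => ⟨fun φ xb => hP.exists_zero_mem_statMap hS,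
      fun xb yb zb => hP.zero_mem_statMap_of_mapClusterPt hS⟩,
      hP.zerosApproximable_of_subsingleton hXν⟩
  · exact zerosApproximable_of_const hh hhν hb
      (fun x hx => hc x (fun _ => x) (fun ν => (hX ν).ge hx) tendsto_const_nhds) hX hF hD

theorem mainTheorem1 {n m : ℕ}
    (X : Set (Rn n)) (Xν : ℕ → Set (Rn n))
    (h : Rn m → EReal) (hν : ℕ → Rn m → EReal)
    (f₀ : Rn n → ℝ) (f₀ν : ℕ → Rn n → ℝ)
    (F : Rn n → Rn m) (Fν : ℕ → Rn n → Rn m)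
    (D : Fin m → Rn n → Set (Rn n)) (Dν : ℕ → Fin m → Rn n → Set (Rn n))
    -- standing assumptions on the data
    (hX_ne : X.Nonempty) (hX_cl : IsClosed X)
    (hXν_ne : ∀ ν, (Xν ν).Nonempty) (hXν_cl : ∀ ν, IsClosed (Xν ν))
    -- the sets are convex, or else they do not depend on `ν`
    (hconv : (Convex ℝ X ∧ ∀ ν, Convex ℝ (Xν ν)) ∨ ∀ ν, Xν ν = X)
    (hh : ProperLscConvex h) (hhν : ∀ ν, ProperLscConvex (hν ν))
    (hf₀ : ContDiff ℝ 1 f₀) (hf₀ν : ∀ ν, ContDiff ℝ 1 (f₀ν ν))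
    (hF : LocallyLipschitz F) (hFν : ∀ ν, LocallyLipschitz (Fν ν))
    -- (a), (b)
    (ha : SetConverges Xν X)
    (hb : EpiConverges hν h)
    -- (c)
    (hc : ∀ (x : Rn n) (xs : ℕ → Rn n), (∀ ν, xs ν ∈ Xν ν) → Tendsto xs atTop (𝓝 x) →
      Tendsto (fun ν => f₀ν ν (xs ν)) atTop (𝓝 (f₀ x)) ∧
      Tendsto (fun ν => ∇ (f₀ν ν) (xs ν)) atTop (𝓝 (∇ f₀ x)))
    -- (d)
    (hd : ∀ (i : Fin m) (x : Rn n) (xs vs : ℕ → Rn n),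
      (∀ ν, xs ν ∈ Xν ν) → Tendsto xs atTop (𝓝 x) → (∀ ν, vs ν ∈ Dν ν i (xs ν)) →
      Tendsto (fun ν => Fν ν (xs ν) i) atTop (𝓝 (F x i)) ∧
      Bornology.IsBounded (Set.range vs) ∧
      ∀ v, MapClusterPt v atTop vs → v ∈ convexHull ℝ (D i x)) :
    -- (i)
    ((∀ ν i, ∀ x ∈ Xν ν, (Dν ν i x).Nonempty) →
      ∀ (ε : ℕ → ℝ) (x : ℕ → Rn n) (y z : ℕ → Rn m),
        NearStationary (fun ν => statMap (Xν ν) (f₀ν ν) (hν ν) (Fν ν) (Dν ν)) ε x y z →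
      ∀ (φ : ℕ → ℕ) (xb : Rn n), StrictMono φ → Tendsto (x ∘ φ) atTop (𝓝 xb) →
      (F xb ∈ effDom h → BasicQualification X h F D xb) →
      (F xb ∉ effDom h → InfeasQualification X D xb) →
      ∃ yb zb : Rn m, 0 ∈ statMap X f₀ h F D xb yb zb) ∧
    -- (ii)
    ((∀ ν i, ∀ x ∈ Xν ν, (Dν ν i x).Nonempty) →
      ∀ (ε : ℕ → ℝ) (x : ℕ → Rn n) (y z : ℕ → Rn m),
        NearStationary (fun ν => statMap (Xν ν) (f₀ν ν) (hν ν) (Fν ν) (Dν ν)) ε x y z →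
      ∀ (xb : Rn n) (yb zb : Rn m),
      MapClusterPt (xb, yb, zb) atTop (fun ν => (x ν, y ν, z ν)) → 0 ∈ statMap X f₀ h F D xb yb zb) ∧
    -- (iii)
    (ContDiff ℝ 1 F → (∀ ν, ContDiff ℝ 1 (Fν ν)) →
      (∀ i x, D i x = {∇ (fun x' => F x' i) x}) →
      (∀ ν i x, Dν ν i x = {∇ (fun x' => Fν ν x' i) x}) →
      ZerosApproximable (statMap X f₀ h F D)
        (fun ν => statMap (Xν ν) (f₀ν ν) (hν ν) (Fν ν) (Dν ν))) ∧
    -- (iv)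
    ((∀ ν, Xν ν = X) → (∀ ν, Fν ν = F) → (∀ ν i, Dν ν i = D i) →
      ZerosApproximable (statMap X f₀ h F D)
        (fun ν => statMap (Xν ν) (f₀ν ν) (hν ν) (Fν ν) (Dν ν))) := by
  obtain ⟨hne, hconst⟩ := mainTheorem1_general ⟨X, f₀, h, F, D⟩
    (fun ν => ⟨Xν ν, f₀ν ν, hν ν, Fν ν, Dν ν⟩) hXν_cl hconv hh hhν
    (hf₀.differentiable one_ne_zero) (fun ν => (hf₀ν ν).differentiable one_ne_zero) ha hb
    (fun x xs hxs hlim => (hc x xs hxs hlim).2) hd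
  exact ⟨fun hD ε x y z hS => ((hne hD).1 ε x y z hS).1,
    fun hD ε x y z hS => ((hne hD).1 ε x y z hS).2,
    fun _ _ hD hDν => (hne fun ν i x _ => (Set.singleton_nonempty _).mono (hDν ν i x).ge).2
      fun i x => Set.subsingleton_singleton.anti (hD i x).le, hconst⟩
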